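/- Let $G$ be a finite group of linear automorphisms of $\mathbb C^n$ that is generated by pseudoreflections (automorphisms $\sigma$ of finite order with $\operatorname{rank}(\mathrm{id}-\sigma)=1$), and let $\theta_1,\dots,\theta_n$ be basic polynomials for $G$, i.e. algebraically independent homogeneous polynomials with $\mathbb C[z_1,\dots,z_n]^G=\mathbb C[\theta_1,\dots,\theta_n]$. Write $\theta_i(z)=\sum_{u\in N_i}a^{(i)}_u z^u$ with $N_i\subset\mathbb N_0^n$ finite and $a^{(i)}_u\in\mathbb C\setminus\{0\}$. Let $D\subset\mathbb C^n$ be a bounded, $G$-invariant complete Reinhardt domain centred at $0$ (a domain containing $0$ that with each point $z$ contains $\{w:|w_j|\le|z_j|,\ 1\le j\le n\}$). Let $\mathbb A^2(D)$ be the Bergman space, i.e. the space of holomorphic functions in $L^2(D)$ with respect to Lebesgue measure, and let $\|\cdot\|$ be its norm. A directed graph is a pair $\mathcal G=(V,E)$ with $V\ne\emptyset$ and $E\subseteq (V\times V)\setminus\{(v,v):v\in V\}$; put $\mathrm{Chi}(v)=\{w:(v,w)\in E\}$ and $\mathrm{Par}(v)=\{w:(w,v)\in E\}$. A generalized directed semi-tree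 $(\mathcal G,m)$ is a directed graph $\mathcal G$ without circuits (directed cycles), with countably many connected components, such that some integer $k\ge 0$ satisfies $\mathrm{card}(\mathrm{Chi}(u)\cap\mathrm{Chi}(v))\le k$ for all distinct $u,v\in V$, and $m$ is the least such $k$. For complex weights $\lambda_{(u,v)}$, $(u,v)\in E$, with $\sum_{u\in\mathrm{Par}(v)}|\lambda_{(u,v)}|^2<\infty$ for every $v\in V$, the weighted shift on $\mathcal G$ is the operator $\Lambda f=Tf$, where $(Tf)(v)=\sum_{u\in \mathrm{Par}(v)}\lambda_{(u,v)}f(u)$ (and $(Tf)(v)=0$ if $\mathrm{Par}(v)=\emptyset$), with domain $\{f\in\ell^2(V):Tf\in\ell^2(V)\}$. For $1\le i\le n$ let $E^{(i)}=\{(\alpha,\alpha+u):\alpha\in\mathbb N_0^n,\ u\in N_i\}$ and $\mathcal G_i=(\mathbb N_0^n,E^{(i)})$. Then for each $i$ there is an integer $0\le c_i'\le\mathrm{card}(N_i)$ such that $(\mathcal G_i,c_i')$ is a generalized directed semi-tree. The weights $$\lambda^{(i)}_{(\alpha,\alpha+u)}=a^{(i)}_u\,\frac{\|z^{\alpha+u}\|}{\|z^\alpha\|},\qquad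 \alpha\in\mathbb N_0^n,\ u\in N_i,$$ satisfy the above square-summability condition. The weighted shift $\Lambda_i$ on $\mathcal G_i$ with these weights is an everywhere defined bounded operator on $\ell^2(\mathbb N_0^n)$ with $\Lambda_i\chi_\alpha=\sum_{u\in N_i}\lambda^{(i)}_{(\alpha,\alpha+u)}\chi_{\alpha+u}$ for all $\alpha$, where $\chi_\alpha$ is the characteristic function of $\{\alpha\}$. The multiplication operator $M_{\theta_i}:f\mapsto\theta_i f$ is an everywhere defined bounded operator on $\mathbb A^2(D)$. Moreover $\Lambda_i$ is unitarily equivalent to $M_{\theta_i}$, simultaneously for all $i$: there is a unitary $U:\ell^2(\mathbb N_0^n)\to\mathbb A^2(D)$ with $U\Lambda_i=M_{\theta_i}U$ for $i=1,\dots,n$. -/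

import Mathlib

open MeasureTheory

/-! ### Directed graphs -/

/-- The children of a vertex. -/
def Digraph.Chi {V : Type*} (G : Digraph V) (u : V) : Set V := {v | G.Adj u v}

/-- The parents of a vertex. -/
def Digraph.Par {V : Type*} (G : Digraph V) (u : V) : Set V := {v | G.Adj v u}

/-- A vertex without parents. -/
def Digraph.IsRoot {V : Type*} (G : Digraph V) (v : V) : Prop := G.Par v = ∅

/-- `G` has a circuit: a finite sequence `c 0, …, c k` (`k ≥ 1`) of distinct vertices with edges
`(c j, c (j+1))` for `j < k` and `(c k, c 0)`. -/
def Digraph.HasCircuit {V : Type*} (G : Digraph V) : Prop :=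
  ∃ (k : ℕ) (c : ℕ → V), 1 ≤ k ∧ Set.InjOn c (Set.Iic k) ∧
    (∀ j < k, G.Adj (c j) (c (j + 1))) ∧ G.Adj (c k) (c 0)

/-- `(G, m)` is a generalized directed semi-tree: `G` is a directed graph without loops on a
nonempty vertex set, it has no circuit and countably many connected components (of the underlying
undirected graph), and `m` is the least nonnegative integer that bounds the number of common
children of any two distinct vertices. -/
structure Digraph.IsGeneralizedDirectedSemiTree {V : Type*} (G : Digraph V) (m : ℕ) : Prop where
  nonempty : Nonempty V
  loopless : ∀ v, ¬ G.Adj v v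
  no_circuit : ¬ G.HasCircuit
  countable_components : Countable G.toSimpleGraphInclusive.ConnectedComponent
  least_bound : IsLeast {k : ℕ | ∀ u v : V, u ≠ v → (G.Chi u ∩ G.Chi v).encard ≤ (k : ℕ∞)} m

/-! ### Weighted shifts -/

/-- The complex Hilbert space `ℓ²(V)`. -/
abbrev EllTwo (V : Type*) : Type _ := lp (fun _ : V => ℂ) 2

/-- The condition on the weights `w u v`, `(u, v)` an edge: for every `v`, the sum of `|w u v| ^ 2`
over the parents `u` of `v` is finite. (Values of `w` off the edges play no role anywhere.) -/
def Digraph.SquareSummableWeights {V : Type*} (G : Digraph V) (w : V → V → ℂ) : Prop :=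
  ∀ v, Summable fun u : G.Par v => ‖w u v‖ ^ 2

open Classical in
/-- The formal weighted shift `T_G` on functions `V → ℂ`. -/
noncomputable def Digraph.formalShift {V : Type*} (G : Digraph V) (w : V → V → ℂ) (f : V → ℂ) :
    V → ℂ :=
  fun v => if G.IsRoot v then 0 else ∑' u : G.Par v, w u v * f u

theorem EllTwo.summable_sq {V : Type*} (f : EllTwo V) : Summable fun v => ‖f v‖ ^ 2 := by
  have h := (lp.memℓp f).summable (by norm_num)
  simpa using h

theorem Digraph.SquareSummableWeights.summable_mul {V : Type*} {G : Digraph V} {w : V → V → ℂ}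
    (hw : G.SquareSummableWeights w) (f : EllTwo V) (v : V) :
    Summable fun u : G.Par v => w u v * f u := by
  have hf : Summable fun u : G.Par v => ‖f u‖ ^ 2 :=
    (EllTwo.summable_sq f).comp_injective Subtype.val_injective
  refine Summable.of_norm_bounded ((hw v).add hf) fun u => ?_
  rw [norm_mul]
  nlinarith [sq_nonneg (‖w u v‖ - ‖f u‖), sq_nonneg ‖w u v‖, sq_nonneg ‖f u‖]

theorem Digraph.SquareSummableWeights.formalShift_add {V : Type*} {G : Digraph V}
    {w : V → V → ℂ} (hw : G.SquareSummableWeights w) (f g : EllTwo V) :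
    G.formalShift w (f + g : EllTwo V) = G.formalShift w f + G.formalShift w g := by
  funext v
  by_cases h : G.IsRoot v
  · simp [Digraph.formalShift, h]
  · simp only [Digraph.formalShift, h, if_false, Pi.add_apply, lp.coeFn_add, mul_add]
    exact (hw.summable_mul f v).tsum_add (hw.summable_mul g v)

theorem Digraph.formalShift_smul {V : Type*} (G : Digraph V)
    (w : V → V → ℂ) (c : ℂ) (f : EllTwo V) :
    G.formalShift w (c • f : EllTwo V) = c • G.formalShift w f := by
  funext v
  by_cases h : G.IsRoot v
  · simp [Digraph.formalShift, h]
  · simp only [Digraph.formalShift, h, if_false, Pi.smul_apply, lp.coeFn_smul, smul_eq_mul,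
      ← tsum_mul_left]
    exact tsum_congr fun u => by ring

/-- The weighted shift `Λ_G` on `G` with weights `w`: the (possibly partially defined) operator on
`ℓ²(V)` with domain `{f ∈ ℓ²(V) | T_G f ∈ ℓ²(V)}` that sends `f` to `T_G f`. -/
noncomputable def Digraph.weightedShift {V : Type*} (G : Digraph V) (w : V → V → ℂ)
    (hw : G.SquareSummableWeights w) : EllTwo V →ₗ.[ℂ] EllTwo V where
  domain :=
    { carrier := {f | Memℓp (G.formalShift w f) 2}
      add_mem' := fun {f g} hf hg => by
        simp only [Set.mem_ofPred_eq] at hf hg ⊢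
        rw [hw.formalShift_add]
        exact Memℓp.add hf hg
      zero_mem' := by
        have h := G.formalShift_smul w 0 0
        simp only [Set.mem_ofPred_eq]
        rw [zero_smul, zero_smul] at h
        rw [h]
        exact zero_memℓp
      smul_mem' := fun c f hf => by
        simp only [Set.mem_ofPred_eq] at hf ⊢
        rw [G.formalShift_smul]
        exact Memℓp.const_smul hf c }
  toFun :=
    { toFun := fun f => ⟨G.formalShift w f.1, f.2⟩
      map_add' := fun f g => Subtype.ext (hw.formalShift_add f.1 g.1)
      map_smul' := fun c f => Subtype.ext (G.formalShift_smul w c f.1) }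

/-! ### Pseudoreflection groups and basic polynomials -/

/-- A pseudoreflection on `ℂⁿ`: a linear automorphism `σ` of finite order such that `id - σ` has
rank one. -/
def IsPseudoreflection {n : ℕ} (σ : (Fin n → ℂ) ≃ₗ[ℂ] (Fin n → ℂ)) : Prop :=
  IsOfFinOrder σ ∧
    Module.finrank ℂ (LinearMap.range (LinearMap.id - (σ : (Fin n → ℂ) →ₗ[ℂ] (Fin n → ℂ)))) = 1

/-- A finite group generated by pseudoreflections. -/
def IsFinitePseudoreflectionGroup {n : ℕ} (G : Subgroup ((Fin n → ℂ) ≃ₗ[ℂ] (Fin n → ℂ))) : Prop :=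
  Finite G ∧ ∃ S : Set ((Fin n → ℂ) ≃ₗ[ℂ] (Fin n → ℂ)),
    (∀ σ ∈ S, IsPseudoreflection σ) ∧ G = Subgroup.closure S

/-- The ring `ℂ[z₁, …, zₙ]^G` of `G`-invariant polynomials. -/
def invariantPolynomials {n : ℕ} (G : Subgroup ((Fin n → ℂ) ≃ₗ[ℂ] (Fin n → ℂ))) :
    Subalgebra ℂ (MvPolynomial (Fin n) ℂ) where
  carrier := {p | ∀ σ ∈ G, ∀ z : Fin n → ℂ, MvPolynomial.eval (σ z) p = MvPolynomial.eval z p}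
  mul_mem' := fun {p q} hp hq σ hσ z => by rw [map_mul, map_mul, hp σ hσ z, hq σ hσ z]
  add_mem' := fun {p q} hp hq σ hσ z => by rw [map_add, map_add, hp σ hσ z, hq σ hσ z]
  algebraMap_mem' := fun c σ _ z => by simp [MvPolynomial.algebraMap_eq]

/-- `θ₁, …, θₙ` are basic polynomials for `G`: algebraically independent homogeneous polynomials
that generate the ring of `G`-invariant polynomials. -/
structure IsBasicPolynomials {n : ℕ} (G : Subgroup ((Fin n → ℂ) ≃ₗ[ℂ] (Fin n → ℂ)))
    (θ : Fin n → MvPolynomial (Fin n) ℂ) : Prop where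
  homogeneous : ∀ i, ∃ d : ℕ, (θ i).IsHomogeneous d
  algebraicIndependent : AlgebraicIndependent ℂ θ
  adjoin_eq : Algebra.adjoin ℂ (Set.range θ) = invariantPolynomials G

/-! ### Bergman spaces -/

/-- A complete Reinhardt domain in `ℂⁿ` with center `0`: open, connected, containing `0`, and with
each of its points `z` it contains the closed polydisc `{w | |w_j| ≤ |z_j| for all j}`. -/
structure IsCompleteReinhardtDomain {n : ℕ} (D : Set (Fin n → ℂ)) : Prop where
  isOpen : IsOpen D
  isConnected : IsConnected D
  zero_mem : (0 : Fin n → ℂ) ∈ D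
  polydisc_subset : ∀ z ∈ D, ∀ w : Fin n → ℂ, (∀ j, ‖w j‖ ≤ ‖z j‖) → w ∈ D

/-- The Bergman space `A²(D)`: the subspace of `L²(D)` (Lebesgue measure) of the classes of
holomorphic functions on `D`. -/
noncomputable def bergmanSpace {n : ℕ} (D : Set (Fin n → ℂ)) :
    Submodule ℂ (Lp ℂ 2 ((volume : Measure (Fin n → ℂ)).restrict D)) where
  carrier := {f | ∃ F : (Fin n → ℂ) → ℂ, DifferentiableOn ℂ F D ∧ f =ᵐ[volume.restrict D] F}
  add_mem' := by
    rintro f g ⟨F, hF, hfF⟩ ⟨H, hH, hgH⟩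
    exact ⟨F + H, hF.add hH, (Lp.coeFn_add f g).trans (hfF.add hgH)⟩
  zero_mem' := ⟨0, differentiableOn_const 0, Lp.coeFn_zero ℂ 2 _⟩
  smul_mem' := by
    rintro c f ⟨F, hF, hfF⟩
    exact ⟨c • F, hF.const_smul c, (Lp.coeFn_smul c f).trans (hfF.const_smul c)⟩

theorem MvPolynomial.differentiable_eval_complex {n : ℕ} (p : MvPolynomial (Fin n) ℂ) :
    Differentiable ℂ fun z : Fin n → ℂ => MvPolynomial.eval z p := by
  induction p using MvPolynomial.induction_on with
  | C a => simp
  | add p q hp hq =>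
    simp only [map_add]
    exact hp.add hq
  | mul_X p i hp =>
    simp only [map_mul, MvPolynomial.eval_X]
    exact hp.mul (differentiable_apply i)

/-- The operator `M_p` of multiplication by the polynomial `p` on `A²(D)`, with its natural domain
`{f ∈ A²(D) | p f ∈ L²(D)}` (the product `p f` is then automatically in `A²(D)`). -/
noncomputable def bergmanMul {n : ℕ} (D : Set (Fin n → ℂ)) (p : MvPolynomial (Fin n) ℂ) :
    bergmanSpace D →ₗ.[ℂ] bergmanSpace D where
  domain :=
    { carrier := {f | MemLp (fun z => MvPolynomial.eval z p * (f : _ → ℂ) z) 2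
        ((volume : Measure (Fin n → ℂ)).restrict D)}
      add_mem' := fun {f g} hf hg => by
        refine (memLp_congr_ae ?_).mp (MemLp.add hf hg)
        filter_upwards [Lp.coeFn_add f.1 g.1] with z hz
        simp only [Submodule.coe_add, hz, Pi.add_apply, mul_add]
      zero_mem' := by
        refine (memLp_congr_ae ?_).mp (MemLp.zero (p := 2))
        filter_upwards [Lp.coeFn_zero ℂ 2 ((volume : Measure (Fin n → ℂ)).restrict D)] with z hz
        simp only [Submodule.coe_zero, hz, Pi.zero_apply, mul_zero]
      smul_mem' := fun c f hf => by
        refine (memLp_congr_ae ?_).mp (MemLp.const_smul hf c)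
        filter_upwards [Lp.coeFn_smul c f.1] with z hz
        simp only [Pi.smul_apply, smul_eq_mul, Submodule.coe_smul, hz]
        ring }
  toFun :=
    { toFun := fun f => ⟨MemLp.toLp _ f.2, by
        obtain ⟨F, hF, hfF⟩ := f.1.2
        refine ⟨fun z => MvPolynomial.eval z p * F z,
          (MvPolynomial.differentiable_eval_complex p).differentiableOn.mul hF, ?_⟩
        filter_upwards [MemLp.coeFn_toLp f.2, hfF] with z h1 h2
        rw [h1, h2]⟩
      map_add' := fun f g => by
        refine Subtype.ext (Lp.ext ?_)
        simp only [Submodule.coe_add]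
        refine (MemLp.coeFn_toLp _).trans (Filter.EventuallyEq.trans ?_ (Lp.coeFn_add _ _).symm)
        filter_upwards [MemLp.coeFn_toLp f.2, MemLp.coeFn_toLp g.2,
          Lp.coeFn_add f.1.1 g.1.1] with z h1 h2 h3
        simp only [h1, h2, h3, Pi.add_apply, mul_add]
      map_smul' := fun c f => by
        refine Subtype.ext (Lp.ext ?_)
        simp only [Submodule.coe_smul, RingHom.id_apply]
        refine (MemLp.coeFn_toLp _).trans (Filter.EventuallyEq.trans ?_ (Lp.coeFn_smul _ _).symm)
        filter_upwards [MemLp.coeFn_toLp f.2, Lp.coeFn_smul c f.1.1] with z h1 h2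
        simp only [Pi.smul_apply, smul_eq_mul, h1, h2]
        ring }

/-! ### The graph and the weights of a polynomial -/

/-- The directed graph on `ℕ₀ⁿ` with edges `(α, α + u)`, `u` ranging over the exponents of the
monomials that occur in `p`. -/
def shiftGraph {n : ℕ} (p : MvPolynomial (Fin n) ℂ) : Digraph (Fin n →₀ ℕ) where
  Adj α β := ∃ u ∈ p.support, β = α + u

/-- The norm of the monomial `z ^ α` in `L²(D)`. -/
noncomputable def monomialNorm {n : ℕ} (D : Set (Fin n → ℂ)) (α : Fin n →₀ ℕ) : ℝ :=
  (eLpNorm (fun z : Fin n → ℂ => ∏ j, z j ^ α j) 2 (volume.restrict D)).toReal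

/-- The weight `a_u ‖z ^ (α + u)‖ / ‖z ^ α‖` of the edge `(α, β)`, `β = α + u`, where `a_u` is the
coefficient of `z ^ u` in `p`. -/
noncomputable def shiftWeight {n : ℕ} (D : Set (Fin n → ℂ)) (p : MvPolynomial (Fin n) ℂ)
    (α β : Fin n →₀ ℕ) : ℂ :=
  p.coeff (β - α) * ((monomialNorm D β / monomialNorm D α : ℝ) : ℂ)

/-! On a bounded complete Reinhardt domain the normalized monomials `z^α / ‖z^α‖` form an
orthonormal basis of `A²(D)`. Multiplication by a polynomial with coefficients `a_u` sends the basis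
vector at `α` to the sum of `a_u ‖z^(α+u)‖ / ‖z^α‖` times those at `α + u`, which is exactly the
weighted shift. The unitary given by this one basis therefore intertwines all the operators at once.

The analytic core is `exists_hilbertBasis_normalizedMonomial`. Orthogonality comes from rotating a
single coordinate. For totality, let `f` be orthogonal to all monomials. Its `k`-th Taylor
coefficient along complex lines through `0` is, up to `k!`, a homogeneous polynomial `P k`.
Averaging over the rotations `z ↦ t z`, which preserve `D`, gives `0 = ⟨P k, f⟩ = ‖P k‖² / k!`, so
every Taylor coefficient vanishes. Completeness of `A²(D)` follows from local bounds on point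
evaluations and Weierstrass' theorem.

On the graph side, the basic polynomials have no constant term, so edges strictly increase in the
order of `ℕ₀ⁿ` and no circuit can occur. -/

/-! ### Holomorphic functions of several variables -/

open Metric in
theorem norm_fderiv_le_of_forall_mem_ball_norm_le {E : Type*} [NormedAddCommGroup E]
    [NormedSpace ℂ E] {f : E → ℂ} {a : E} {r C : ℝ} (hr : 0 < r)
    (hf : DifferentiableOn ℂ f (ball a r)) (hC : ∀ z ∈ ball a r, ‖f z‖ ≤ C) :
    ‖fderiv ℂ f a‖ ≤ 2 * C / r := by
  refine Complex.norm_fderiv_le_div_of_mapsTo_ball hf (fun z hz => ?_) hr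
  rw [mem_closedBall, dist_eq_norm]
  have := hC z hz
  have := hC a (mem_ball_self hr)
  exact (norm_sub_le _ _).trans (by linarith)

open Metric Filter Topology in
/-- Weierstrass' theorem: a uniform limit of holomorphic functions is holomorphic. -/
theorem differentiableAt_of_tendstoUniformlyOn_ball {E : Type*} [NormedAddCommGroup E]
    [NormedSpace ℂ E] {f : ℕ → E → ℂ} {g : E → ℂ} {a : E} {r : ℝ} (hr : 0 < r)
    (hf : ∀ n, DifferentiableOn ℂ (f n) (ball a r))
    (hfg : TendstoUniformlyOn f g atTop (ball a r)) : DifferentiableAt ℂ g a := by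
  have hsub : ∀ z ∈ ball a (r / 2), ball z (r / 2) ⊆ ball a r := fun z hz =>
    ball_subset_ball' (by rw [mem_ball] at hz; linarith)
  -- The Cauchy estimate for `f m - f n` on balls of radius `r / 2` turns the bound `ε * r / 8` into
  -- `ε / 2` for the derivatives.
  have hcau : UniformCauchySeqOn (fun n => fderiv ℂ (f n)) atTop (ball a (r / 2)) := by
    rw [Metric.uniformCauchySeqOn_iff]
    intro ε hε
    obtain ⟨N, hN⟩ := Metric.uniformCauchySeqOn_iff.1 hfg.uniformCauchySeqOn (ε * r / 8)
      (by positivity)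
    refine ⟨N, fun m hm n hn z hz => ?_⟩
    have hd : ∀ k, DifferentiableOn ℂ (f k) (ball z (r / 2)) := fun k => (hf k).mono (hsub z hz)
    have hz' : ball z (r / 2) ∈ 𝓝 z := ball_mem_nhds _ (by positivity)
    have h := norm_fderiv_le_of_forall_mem_ball_norm_le (half_pos hr) ((hd m).sub (hd n))
      (C := ε * r / 8) fun w hw => by
        rw [Pi.sub_apply, ← dist_eq_norm]
        exact (hN m hm n hn w (hsub z hz hw)).le
    rw [fderiv_sub ((hd m).differentiableAt hz') ((hd n).differentiableAt hz')] at h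
    rw [dist_eq_norm]
    refine h.trans_lt ?_
    field_simp
    linarith
  have hlim : ∀ z ∈ ball a (r / 2), ∃ L, Tendsto (fun n => fderiv ℂ (f n) z) atTop (𝓝 L) :=
    fun z hz => cauchySeq_tendsto_of_complete (hcau.cauchySeq hz)
  choose! g' hg' using hlim
  have hu := hcau.tendstoUniformlyOn_of_tendsto hg'
  refine (hasFDerivAt_of_tendstoUniformlyOn isOpen_ball hu (fun n z hz => ?_)
    (fun z hz => hfg.tendsto_at (hsub a (mem_ball_self (half_pos hr))
      (by simpa using hz))) (mem_ball_self (half_pos hr))).differentiableAt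
  exact ((hf n).differentiableAt (isOpen_ball.mem_nhds
    (ball_subset_ball (by linarith) hz))).hasFDerivAt

-- The difference quotients in direction `w` are holomorphic and converge locally uniformly, because
-- the first-order Taylor remainder is quadratic with a locally uniform constant. Weierstrass'
-- theorem then applies to their limit.
open Metric Filter Topology in
theorem differentiableOn_fderiv_apply {E : Type*} [NormedAddCommGroup E]
    [NormedSpace ℂ E] {F : E → ℂ} {U : Set E} (hU : IsOpen U) (hF : DifferentiableOn ℂ F U)
    (w : E) : DifferentiableOn ℂ (fun z => fderiv ℂ F z w) U := by
  intro a ha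
  refine DifferentiableAt.differentiableWithinAt ?_
  have hcont : ContinuousAt F a := hF.continuousOn.continuousAt (hU.mem_nhds ha)
  obtain ⟨R, hR, hRb⟩ : ∃ R > 0, ball a R ⊆ U ∩ {z | dist (F z) (F a) < 1} :=
    Metric.mem_nhds_iff.1 (inter_mem (hU.mem_nhds ha) (hcont (ball_mem_nhds _ one_pos)))
  set r := R / 2 with hr
  have hr0 : 0 < r := half_pos hR
  have hsub : ∀ z ∈ ball a r, ball z r ⊆ ball a R := fun z hz =>
    ball_subset_ball' (by rw [mem_ball] at hz; linarith)
  have hdiff : ∀ z ∈ ball a R, DifferentiableAt ℂ F z := fun z hz =>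
    hF.differentiableAt (hU.mem_nhds (hRb hz).1)
  have hosc : ∀ z ∈ ball a R, ∀ y ∈ ball a R, ‖F y - F z‖ ≤ 2 := fun z hz y hy => by
    have h1 : dist (F z) (F a) < 1 := (hRb hz).2
    have h2 : dist (F y) (F a) < 1 := (hRb hy).2
    rw [← dist_eq_norm]
    linarith [dist_triangle_right (F y) (F z) (F a)]
  -- Higher-order Schwarz lemma: the remainder is `o(‖h‖)` at `0` and bounded by `4` on the ball,
  -- namely `2` from the oscillation of `F` and `2 / r * r` from the linear term.
  have hquad : ∀ z ∈ ball a r, ∀ h ∈ ball (0 : E) r,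
      ‖F (z + h) - F z - fderiv ℂ F z h‖ ≤ 4 * (‖h‖ / r) ^ 2 := by
    intro z hz h hh
    have hzR : z ∈ ball a R := hsub z hz (mem_ball_self hr0)
    have hmem : ∀ y ∈ ball (0 : E) r, z + y ∈ ball z r := fun y hy => by
      simpa [dist_eq_norm] using hy
    have hbd : ‖fderiv ℂ F z‖ ≤ 2 / r :=
      Complex.norm_fderiv_le_div_of_mapsTo_ball
        (fun y hy => (hdiff y (hsub z hz hy)).differentiableWithinAt)
        (fun y hy => by
          rw [mem_closedBall, dist_eq_norm]
          exact hosc z hzR y (hsub z hz hy)) hr0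
    have key := Complex.dist_le_mul_div_pow_of_mapsTo_ball_of_isLittleO (n := 1) (R₂ := 4)
      (f := fun y => F (z + y) - F z - fderiv ℂ F z y) (c := 0) (z := h) (R₁ := r) ?_ ?_ ?_ hh
    · simpa [dist_eq_norm] using key
    · intro y hy
      have h1 : DifferentiableAt ℂ (fun y => F (z + y)) y :=
        DifferentiableAt.comp (g := F) y (hdiff _ (hsub z hz (hmem y hy))) (by fun_prop)
      exact ((h1.sub_const _).sub (by fun_prop)).differentiableWithinAt
    · intro y hy
      simp only [mem_closedBall, dist_eq_norm, add_zero, sub_self, map_zero, sub_zero]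
      have h1 := hosc z hzR _ (hsub z hz (hmem y hy))
      have h2 : ‖fderiv ℂ F z y‖ ≤ 2 / r * r := ((fderiv ℂ F z).le_opNorm y).trans
        (mul_le_mul hbd (by simpa using (mem_ball_zero_iff.1 hy).le) (norm_nonneg _)
          (by positivity))
      rw [div_mul_cancel₀ _ hr0.ne'] at h2
      exact (norm_sub_le _ _).trans (by linarith)
    · have h1 := (hasFDerivAt_iff_isLittleO_nhds_zero.1 (hdiff z hzR).hasFDerivAt)
      simpa using h1.norm_right
  -- Steps of size at most `c` along `w` stay shorter than `r`, so they do not leave the ball of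
  -- radius `R` about `a`.
  obtain ⟨c, hc0, hc⟩ : ∃ c : ℝ, 0 < c ∧ c * ‖w‖ < r :=
    ⟨r / (‖w‖ + 1), by positivity, by
      rw [div_mul_eq_mul_div, div_lt_iff₀ (by positivity)]; nlinarith [norm_nonneg w]⟩
  set s : ℕ → ℝ := fun m => c / (m + 1) with hs
  have hs0 : ∀ m, 0 < s m := fun m => by positivity
  have hsc : ∀ m, s m ≤ c := fun m => div_le_self hc0.le (by simp)
  have hsn : ∀ m, ‖(s m : ℂ) • w‖ = s m * ‖w‖ := fun m => by
    rw [norm_smul, Complex.norm_real, Real.norm_of_nonneg (hs0 m).le]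
  have hsw : ∀ m, (s m : ℂ) • w ∈ ball (0 : E) r := fun m => by
    rw [mem_ball_zero_iff, hsn]
    exact (mul_le_mul_of_nonneg_right (hsc m) (norm_nonneg w)).trans_lt hc
  have hslim : Tendsto s atTop (𝓝 0) := tendsto_const_div_atTop_nhds_zero_nat c |>.comp
    (tendsto_add_atTop_nat 1) |>.congr fun m => by simp [hs]
  refine differentiableAt_of_tendstoUniformlyOn_ball (r := r) hr0
    (f := fun m z => (s m : ℂ)⁻¹ * (F (z + (s m : ℂ) • w) - F z)) (fun m z hz => ?_) ?_
  · have hz1 : z + (s m : ℂ) • w ∈ ball a R := hsub z hz (by simpa [dist_eq_norm] using hsw m)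
    have h1 : DifferentiableAt ℂ (fun y => F (y + (s m : ℂ) • w)) z :=
      DifferentiableAt.comp (g := F) z (hdiff _ hz1) (by fun_prop)
    exact ((h1.sub (hdiff z (hsub z hz (mem_ball_self hr0)))).const_mul _).differentiableWithinAt
  · rw [Metric.tendstoUniformlyOn_iff]
    intro ε hε
    have hlim : Tendsto (fun m => s m * (4 * (‖w‖ / r) ^ 2)) atTop (𝓝 0) := by
      simpa using hslim.mul_const (4 * (‖w‖ / r) ^ 2)
    filter_upwards [hlim.eventually (gt_mem_nhds hε)] with m hm z hz
    have hsm : (s m : ℂ) ≠ 0 := by exact_mod_cast (hs0 m).ne'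
    have h1 := hquad z hz _ (hsw m)
    rw [map_smul, hsn, smul_eq_mul] at h1
    have h2 : (s m : ℂ)⁻¹ * (F (z + (s m : ℂ) • w) - F z) - fderiv ℂ F z w =
        (s m : ℂ)⁻¹ * (F (z + (s m : ℂ) • w) - F z - (s m : ℂ) * fderiv ℂ F z w) := by
      field_simp
    rw [dist_comm, dist_eq_norm, h2, norm_mul, norm_inv, Complex.norm_real,
      Real.norm_of_nonneg (hs0 m).le]
    refine lt_of_le_of_lt ?_ hm
    rw [inv_mul_le_iff₀ (hs0 m)]
    refine h1.trans (le_of_eq ?_)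
    ring

open Filter Topology in
/-- The Taylor coefficients of a holomorphic function along complex lines through `0` are
homogeneous polynomials in the direction. -/
theorem exists_isHomogeneous_iteratedDeriv_line {n : ℕ} (k : ℕ) :
    ∀ {F : (Fin n → ℂ) → ℂ} {U : Set (Fin n → ℂ)}, IsOpen U → 0 ∈ U → DifferentiableOn ℂ F U →
      ∃ P : MvPolynomial (Fin n) ℂ, P.IsHomogeneous k ∧
        ∀ z, iteratedDeriv k (fun t : ℂ => F (t • z)) 0 = MvPolynomial.eval z P := by
  induction k with
  | zero =>
    intro F U hU h0 hF
    exact ⟨MvPolynomial.C (F 0), MvPolynomial.isHomogeneous_C _ _, fun z => by simp⟩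
  | succ k ih =>
    intro F U hU h0 hF
    have hd := fun j : Fin n => differentiableOn_fderiv_apply hU hF (Pi.single j 1)
    choose P hP hPe using fun j => ih hU h0 (hd j)
    -- By the chain rule the derivative of `t ↦ F (t z)` is `∑ z_j (∂_j F)(t z)`. The induction
    -- hypothesis is applied to each `∂_j F`.
    refine ⟨∑ j, MvPolynomial.X j * P j, MvPolynomial.IsHomogeneous.sum _ _ _ fun j _ => ?_,
      fun z => ?_⟩
    · rw [add_comm]
      exact (MvPolynomial.isHomogeneous_X _ _).mul (hP j)
    have hcont : Continuous fun t : ℂ => t • z := by fun_prop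
    have hW : IsOpen ((fun t : ℂ => t • z) ⁻¹' U) := hU.preimage hcont
    have hW0 : (0 : ℂ) ∈ (fun t : ℂ => t • z) ⁻¹' U := by simpa using h0
    have hderiv : deriv (fun t : ℂ => F (t • z)) =ᶠ[𝓝 0]
        fun t => ∑ j, z j * fderiv ℂ F (t • z) (Pi.single j 1) := by
      filter_upwards [hW.mem_nhds hW0] with t ht
      have h1 : HasDerivAt (fun t : ℂ => t • z) z t := by
        simpa using (hasDerivAt_id t).smul_const z
      have h2 := (hF.differentiableAt (hU.mem_nhds ht)).hasFDerivAt.comp_hasDerivAt t h1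
      rw [show (fun t : ℂ => F (t • z)) = F ∘ fun t : ℂ => t • z from rfl, h2.deriv]
      refine (congrArg (fderiv ℂ F (t • z)) (pi_eq_sum_univ' z)).trans ?_
      simp only [map_sum, map_smul, smul_eq_mul]
    have hsm : ∀ j : Fin n, ContDiffAt ℂ k
        (fun t : ℂ => fderiv ℂ F (t • z) (Pi.single j 1)) 0 := fun j => by
      have : DifferentiableOn ℂ (fun t : ℂ => fderiv ℂ F (t • z) (Pi.single j 1))
          ((fun t : ℂ => t • z) ⁻¹' U) := by
        exact (hd j).comp (by fun_prop) (fun t ht => ht)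
      exact (this.analyticAt (hW.mem_nhds hW0)).contDiffAt
    rw [iteratedDeriv_succ', hderiv.iteratedDeriv_eq]
    rw [iteratedDeriv_fun_sum fun j _ => contDiffAt_const.mul (hsm j)]
    simp only [map_sum, map_mul, MvPolynomial.eval_X, ← hPe]
    refine Finset.sum_congr rfl fun j _ => ?_
    exact iteratedDeriv_const_mul_field _ _

/-! ### Circle averages and rotation invariance -/

/-- The Fourier coefficients of a holomorphic function on the unit circle are its Taylor
coefficients. -/
theorem circleAverage_inv_pow_mul {φ : ℂ → ℂ} (k : ℕ)
    (hφ : DifferentiableOn ℂ φ (Metric.closedBall 0 1)) :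
    Real.circleAverage (fun t => (t ^ k)⁻¹ * φ t) 0 1 =
      (k.factorial : ℂ)⁻¹ * iteratedDeriv k φ 0 := by
  have h := hφ.circleIntegral_one_div_sub_center_pow_smul one_pos k
  rw [Real.circleAverage_eq_circleIntegral one_ne_zero]
  -- The circle average is taken against `dz / (2πi z)`. The extra `z⁻¹` raises the exponent to the
  -- `k + 1` of Cauchy's formula.
  have h2 : (∮ z in C(0, 1), (z - 0)⁻¹ • ((z ^ k)⁻¹ * φ z)) =
      ∮ z in C(0, 1), (1 / (z - 0) ^ (k + 1)) • φ z := by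
    congr 1
    ext z
    simp only [sub_zero, smul_eq_mul, one_div, pow_succ', mul_inv]
    ring
  rw [h2, h, smul_smul, smul_eq_mul]
  have := Complex.two_pi_I_ne_zero
  congr 1
  field_simp

/-- Multiplying the coordinates of `ℂⁿ` by unimodular scalars preserves Lebesgue measure. -/
theorem measurePreserving_mul_of_norm_eq_one {n : ℕ} {c : Fin n → ℂ} (hc : ∀ j, ‖c j‖ = 1) :
    MeasurePreserving (fun z : Fin n → ℂ => c * z) := by
  have h : ∀ j, MeasurePreserving (fun x : ℂ => c j * x) := fun j => by
    exact (rotation ⟨c j, mem_sphere_zero_iff_norm.2 (hc j)⟩).measurePreserving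
  exact volume_preserving_pi h

theorem measurePreserving_restrict_mul {n : ℕ} {S : Set (Fin n → ℂ)} (hS : MeasurableSet S)
    {c : Fin n → ℂ} (hc : ∀ j, ‖c j‖ = 1) (hcS : ∀ z, c * z ∈ S ↔ z ∈ S) :
    MeasurePreserving (fun z : Fin n → ℂ => c * z) (volume.restrict S) (volume.restrict S) := by
  have h := (measurePreserving_mul_of_norm_eq_one hc).restrict_preimage hS
  rwa [show (fun z => c * z) ⁻¹' S = S from Set.ext hcS] at h

/-- Averaging over the circle action does not change the integral with respect to a
circle-invariant measure. -/
theorem integral_circleAverage_smul {n : ℕ} {μ : Measure (Fin n → ℂ)} [SFinite μ]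
    (hμ : ∀ c : ℂ, ‖c‖ = 1 → MeasurePreserving (fun z : Fin n → ℂ => c • z) μ μ)
    {g : (Fin n → ℂ) → ℂ} (hg : Integrable g μ) :
    ∫ z, Real.circleAverage (fun t => g (t • z)) 0 1 ∂μ = ∫ z, g z ∂μ := by
  have hμ' : ∀ θ : ℝ, MeasurePreserving (fun z : Fin n → ℂ => circleMap 0 1 θ • z) μ μ :=
    fun θ => hμ _ (by simp)
  -- This skew rotation preserves the product measure, so the rotated integrand is jointly
  -- integrable and Fubini applies.
  have hskew : MeasurePreserving
      (fun p : ℝ × (Fin n → ℂ) => (p.1, circleMap 0 1 p.1 • p.2))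
      ((volume.restrict (Set.uIoc 0 (2 * Real.pi))).prod μ)
      ((volume.restrict (Set.uIoc 0 (2 * Real.pi))).prod μ) :=
    (MeasurePreserving.id _).skew_product (g := fun θ z => circleMap 0 1 θ • z)
      (by
        have : Continuous fun p : ℝ × (Fin n → ℂ) => circleMap 0 1 p.1 • p.2 := by fun_prop
        exact this.measurable)
      (Filter.Eventually.of_forall fun θ => (hμ' θ).map_eq)
  have : IsFiniteMeasure (volume.restrict (Set.uIoc 0 (2 * Real.pi))) :=
    inferInstanceAs (IsFiniteMeasure (volume.restrict (Set.Ioc _ _)))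
  have hint := hskew.integrable_comp_of_integrable
    (hg.comp_snd (volume.restrict (Set.uIoc 0 (2 * Real.pi))))
  have hθ : ∀ θ : ℝ, ∫ z, g (circleMap 0 1 θ • z) ∂μ = ∫ z, g z ∂μ := fun θ => by
    have h := integral_map (hμ' θ).aemeasurable (f := g)
      (by rw [(hμ' θ).map_eq]; exact hg.aestronglyMeasurable)
    rwa [(hμ' θ).map_eq, eq_comm] at h
  simp only [Real.circleAverage_def]
  rw [integral_smul, ← intervalIntegral_integral_swap
    (f := fun θ z => g (circleMap 0 1 θ • z)) hint]
  simp only [hθ, intervalIntegral.integral_const, sub_zero, smul_smul]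
  rw [inv_mul_cancel₀ (by positivity), one_smul]

/-! ### Point evaluations and completeness of the Bergman space -/

open Metric in
/-- Point evaluations are locally uniformly bounded on square integrable holomorphic functions. -/
theorem exists_forall_norm_le_mul_eLpNorm (n : ℕ) {r : ℝ} (hr : 0 < r) :
    ∃ C : ℝ, 0 ≤ C ∧ ∀ {D : Set (Fin n → ℂ)} {F : (Fin n → ℂ) → ℂ} {a : Fin n → ℂ},
      ball a r ⊆ D → DifferentiableOn ℂ F D → MemLp F 2 (volume.restrict D) →
      ‖F a‖ ≤ C * (eLpNorm F 2 (volume.restrict D)).toReal := by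
  set B : Set (Fin n → ℂ) := ball 0 r with hB
  have hV0 : 0 < volume.real B := by
    rw [measureReal_def]
    exact ENNReal.toReal_pos (measure_ball_pos _ _ hr).ne' measure_ball_lt_top.ne
  have : IsFiniteMeasure (volume.restrict B) := ⟨by
    rw [Measure.restrict_apply_univ]; exact measure_ball_lt_top⟩
  -- The inverse volume comes from the mean value property, the other factor from comparing `L¹`
  -- with `L²`. Neither depends on `a`, `D` or `F`.
  refine ⟨(volume.real B)⁻¹ *
    (volume B ^ (1 / (1 : ENNReal).toReal - 1 / (2 : ENNReal).toReal)).toReal,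
    by positivity, ?_⟩
  intro D F a haD hF hL
  have hpres : MeasurePreserving (fun v : Fin n → ℂ => a + v) (volume.restrict B)
      (volume.restrict (ball a r)) := by
    have h := (measurePreserving_add_left (volume : Measure (Fin n → ℂ)) a).restrict_preimage
      (measurableSet_ball (x := a) (ε := r))
    rwa [show (fun v => a + v) ⁻¹' ball a r = B by ext v; simp [hB, dist_eq_norm]] at h
  have hLa : MemLp F 2 (volume.restrict (ball a r)) :=
    hL.mono_measure (Measure.restrict_mono haD le_rfl)
  have hLB : MemLp (fun v => F (a + v)) 2 (volume.restrict B) := hLa.comp_measurePreserving hpres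
  have hint : Integrable (fun v => F (a + v)) (volume.restrict B) :=
    hLB.integrable (by norm_num)
  have hinv : ∀ c : ℂ, ‖c‖ = 1 → MeasurePreserving (fun z : Fin n → ℂ => c • z)
      (volume.restrict B) (volume.restrict B) := fun c hc =>
    measurePreserving_restrict_mul (c := fun _ => c) measurableSet_ball (fun _ => hc) fun z => by
      rw [show (fun _ => c) * z = c • z from rfl]
      simp [norm_smul, hc]
  have hmean := integral_circleAverage_smul hinv hint
  -- On each circle `t ↦ a + t • v` the average of `F` is `F a`. With rotation invariance of the
  -- ball this gives the mean value property over the ball.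
  have hconst : ∫ v in B, Real.circleAverage (fun t => F (a + t • v)) 0 1 =
      volume.real B • F a := by
    rw [← setIntegral_const]
    refine setIntegral_congr_fun measurableSet_ball fun v hv => ?_
    have hd : DifferentiableOn ℂ (fun t : ℂ => F (a + t • v)) (closedBall 0 1) := by
      refine hF.comp (by fun_prop) fun t ht => haD ?_
      rw [mem_closedBall_zero_iff] at ht
      rw [hB, mem_ball_zero_iff] at hv
      rw [mem_ball, dist_eq_norm, add_sub_cancel_left, norm_smul]
      exact (mul_le_of_le_one_left (norm_nonneg _) ht).trans_lt hv
    simpa using circleAverage_inv_pow_mul 0 hd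
  rw [hconst] at hmean
  have h1 : volume.real B * ‖F a‖ ≤
      (eLpNorm (fun v => F (a + v)) 1 (volume.restrict B)).toReal := by
    rw [← abs_of_pos hV0, ← Real.norm_eq_abs, ← norm_smul, hmean, eLpNorm_one_eq_lintegral_enorm,
      ← integral_norm_eq_lintegral_enorm hint.aestronglyMeasurable]
    exact norm_integral_le_integral_norm _
  have h2 := eLpNorm_le_eLpNorm_mul_rpow_measure_univ (p := 1) (q := 2) (by norm_num)
    hint.aestronglyMeasurable
  rw [Measure.restrict_apply_univ] at h2
  have h3 : eLpNorm (fun v => F (a + v)) 2 (volume.restrict B) ≤ eLpNorm F 2 (volume.restrict D) :=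
    (eLpNorm_comp_measurePreserving hLa.aestronglyMeasurable hpres).trans_le
      (eLpNorm_mono_measure _ (Measure.restrict_mono haD le_rfl))
  have h4 := h2.trans (mul_le_mul_left h3 _)
  have h5 : (eLpNorm (fun v => F (a + v)) 1 (volume.restrict B)).toReal ≤ _ :=
    ENNReal.toReal_mono (ENNReal.mul_ne_top hL.eLpNorm_ne_top
      (ENNReal.rpow_ne_top_of_nonneg (by norm_num) measure_ball_lt_top.ne)) h4
  rw [ENNReal.toReal_mul] at h5
  rw [mul_assoc, ← div_eq_inv_mul, le_div_iff₀ hV0, mul_comm, mul_comm (ENNReal.toReal _)]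
  exact h1.trans h5

-- Bounded point evaluations make an `L²`-convergent sequence locally uniformly Cauchy, so its
-- pointwise limit is holomorphic. An a.e. convergent subsequence identifies that limit with the
-- `L²` limit.
open Metric Filter Topology in
theorem isClosed_bergmanSpace {n : ℕ} {D : Set (Fin n → ℂ)} (hD : IsOpen D) :
    IsClosed (bergmanSpace D : Set (Lp ℂ 2 ((volume : Measure (Fin n → ℂ)).restrict D))) := by
  refine IsSeqClosed.isClosed fun f g hf hfg => ?_
  choose F hF hfF using hf
  have hsub : ∀ k l, MemLp (F k - F l) 2 (volume.restrict D) ∧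
      (eLpNorm (F k - F l) 2 (volume.restrict D)).toReal = dist (f k) (f l) := fun k l => by
    have h : (f k - f l : Lp ℂ 2 _) =ᵐ[volume.restrict D] F k - F l :=
      (Lp.coeFn_sub _ _).trans ((hfF k).sub (hfF l))
    exact ⟨(memLp_congr_ae h).1 (Lp.memLp _),
      by rw [← eLpNorm_congr_ae h, dist_eq_norm, Lp.norm_def]⟩
  have hcau : ∀ a ∈ D, ∃ r > 0, ball a r ⊆ D ∧ UniformCauchySeqOn F atTop (ball a r) := by
    intro a ha
    obtain ⟨R, hR, hRD⟩ := Metric.isOpen_iff.1 hD a ha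
    -- Balls of radius `R / 2` about points of `ball a (R / 2)` stay in `D`, so one constant serves
    -- all these points.
    obtain ⟨C, hC, hCF⟩ := exists_forall_norm_le_mul_eLpNorm n (half_pos hR)
    refine ⟨R / 2, half_pos hR, (ball_subset_ball (by linarith)).trans hRD, ?_⟩
    rw [Metric.uniformCauchySeqOn_iff]
    intro ε hε
    obtain ⟨N, hN⟩ := Metric.cauchySeq_iff.1 hfg.cauchySeq (ε / (C + 1)) (by positivity)
    refine ⟨N, fun k hk l hl z hz => ?_⟩
    have h := hCF (D := D) (F := F k - F l) (a := z)
      ((ball_subset_ball' (by rw [mem_ball] at hz; linarith)).trans hRD)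
      ((hF k).sub (hF l)) (hsub k l).1
    rw [(hsub k l).2, Pi.sub_apply, ← dist_eq_norm] at h
    have h2 := hN k hk l hl
    rw [lt_div_iff₀ (by positivity)] at h2
    nlinarith [dist_nonneg (x := f k) (y := f l)]
  have hlim : ∀ a ∈ D, ∃ w, Tendsto (fun k => F k a) atTop (𝓝 w) := fun a ha => by
    obtain ⟨r, hr, -, h⟩ := hcau a ha
    exact cauchySeq_tendsto_of_complete (h.cauchySeq (mem_ball_self hr))
  choose! H hH using hlim
  refine ⟨H, fun a ha => ?_, ?_⟩
  · obtain ⟨r, hr, hrD, h⟩ := hcau a ha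
    exact (differentiableAt_of_tendstoUniformlyOn_ball hr (fun k => (hF k).mono hrD)
      (h.tendstoUniformlyOn_of_tendsto fun z hz => hH z (hrD hz))).differentiableWithinAt
  · obtain ⟨ns, hns, hae⟩ := (tendstoInMeasure_of_tendsto_Lp hfg).exists_seq_tendsto_ae
    filter_upwards [hae, ae_all_iff.2 hfF, ae_restrict_mem hD.measurableSet] with z h1 h2 hz
    simp only [h2] at h1
    exact tendsto_nhds_unique h1 ((hH z hz).comp hns.tendsto_atTop)

theorem completeSpace_bergmanSpace {n : ℕ} {D : Set (Fin n → ℂ)} (hD : IsOpen D) :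
    CompleteSpace (bergmanSpace D) :=
  (isClosed_bergmanSpace hD).completeSpace_coe

/-! ### Reinhardt domains and polynomials in the Bergman space -/

theorem IsCompleteReinhardtDomain.mul_mem_iff {n : ℕ} {D : Set (Fin n → ℂ)}
    (hD : IsCompleteReinhardtDomain D) {c : Fin n → ℂ} (hc : ∀ j, ‖c j‖ = 1) (z : Fin n → ℂ) :
    c * z ∈ D ↔ z ∈ D :=
  ⟨fun h => hD.polydisc_subset _ h z fun j => by simp [hc],
    fun h => hD.polydisc_subset _ h _ fun j => by simp [hc]⟩

/-- Openness at `z` leaves room beyond `z` on its ray. Radius greater than `1` puts both the unit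
circle and the point `t = 1` inside the disc where `t ↦ F (t z)` is holomorphic. -/
theorem IsCompleteReinhardtDomain.exists_one_lt_smul_mem {n : ℕ} {D : Set (Fin n → ℂ)}
    (hD : IsCompleteReinhardtDomain D) {z : Fin n → ℂ} (hz : z ∈ D) :
    ∃ R : ℝ, 1 < R ∧ ∀ t ∈ Metric.ball (0 : ℂ) R, t • z ∈ D := by
  have hcont : Continuous fun R : ℝ => (R : ℂ) • z := by fun_prop
  have hev : ∀ᶠ R : ℝ in nhds 1, (R : ℂ) • z ∈ D :=
    hcont.continuousAt.eventually (hD.isOpen.mem_nhds (by simpa using hz))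
  obtain ⟨R, hR, hR1⟩ := ((hev.filter_mono nhdsWithin_le_nhds).and
    (self_mem_nhdsWithin : Set.Ioi (1 : ℝ) ∈ nhdsWithin 1 (Set.Ioi 1))).exists
  refine ⟨R, hR1, fun t ht => hD.polydisc_subset _ hR _ fun j => ?_⟩
  have : (0 : ℝ) < R := one_pos.trans hR1
  simp only [Pi.smul_apply, smul_eq_mul, norm_mul, Complex.norm_real, Real.norm_of_nonneg this.le]
  exact mul_le_mul_of_nonneg_right (mem_ball_zero_iff.1 ht).le (norm_nonneg _)

theorem MvPolynomial.IsHomogeneous.eval_smul_vec {σ R : Type*} [Fintype σ] [CommSemiring R] {k : ℕ}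
    {P : MvPolynomial σ R} (hP : P.IsHomogeneous k) (c : R) (z : σ → R) :
    MvPolynomial.eval (c • z) P = c ^ k * MvPolynomial.eval z P := by
  rw [MvPolynomial.eval_eq', MvPolynomial.eval_eq', Finset.mul_sum]
  refine Finset.sum_congr rfl fun d hd => ?_
  have h : ∑ i, d i = k := by
    rw [← hP (MvPolynomial.mem_support_iff.1 hd), Finsupp.weight_apply,
      Finsupp.sum_fintype _ _ (by simp)]
    simp
  simp only [Pi.smul_apply, smul_eq_mul, mul_pow, Finset.prod_mul_distrib,
    Finset.prod_pow_eq_pow_sum, h]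
  ring

theorem MvPolynomial.exists_norm_eval_le {n : ℕ} {D : Set (Fin n → ℂ)}
    (hb : Bornology.IsBounded D) (p : MvPolynomial (Fin n) ℂ) :
    ∃ C : ℝ, 0 ≤ C ∧ ∀ z ∈ D, ‖MvPolynomial.eval z p‖ ≤ C := by
  obtain ⟨C, hC⟩ := hb.isCompact_closure.exists_bound_of_continuousOn
    p.differentiable_eval_complex.continuous.continuousOn
  exact ⟨max C 0, le_max_right _ _, fun z hz => (hC z (subset_closure hz)).trans (le_max_left _ _)⟩

theorem MvPolynomial.memLp_eval {n : ℕ} {D : Set (Fin n → ℂ)} (hD : IsOpen D)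
    (hb : Bornology.IsBounded D) (p : MvPolynomial (Fin n) ℂ) :
    MemLp (fun z => MvPolynomial.eval z p) 2 (volume.restrict D) := by
  obtain ⟨C, -, hC⟩ := p.exists_norm_eval_le hb
  have : IsFiniteMeasure (volume.restrict D) := ⟨by
    rw [Measure.restrict_apply_univ]; exact hb.measure_lt_top⟩
  exact MemLp.of_bound p.differentiable_eval_complex.continuous.aestronglyMeasurable C
    ((ae_restrict_mem hD.measurableSet).mono hC)

/-- The polynomials as elements of the Bergman space of a bounded open set. -/
noncomputable def bergmanPoly {n : ℕ} {D : Set (Fin n → ℂ)} (hD : IsOpen D)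
    (hb : Bornology.IsBounded D) : MvPolynomial (Fin n) ℂ →ₗ[ℂ] bergmanSpace D where
  toFun p := ⟨(p.memLp_eval hD hb).toLp _, fun z => MvPolynomial.eval z p,
    p.differentiable_eval_complex.differentiableOn, MemLp.coeFn_toLp _⟩
  map_add' p q := by
    refine Subtype.ext (Eq.trans ?_
      (MemLp.toLp_add (p.memLp_eval hD hb) (q.memLp_eval hD hb)))
    exact MemLp.toLp_congr ((p + q).memLp_eval hD hb) _
      (Filter.Eventually.of_forall fun z => by simp)
  map_smul' c p := by
    refine Subtype.ext (Eq.trans ?_ (MemLp.toLp_const_smul c (p.memLp_eval hD hb)))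
    exact MemLp.toLp_congr ((c • p).memLp_eval hD hb) _
      (Filter.Eventually.of_forall fun z => by simp)

theorem coeFn_bergmanPoly {n : ℕ} {D : Set (Fin n → ℂ)} (hD : IsOpen D)
    (hb : Bornology.IsBounded D) (p : MvPolynomial (Fin n) ℂ) :
    ((bergmanPoly hD hb p : bergmanSpace D) : (Fin n → ℂ) → ℂ) =ᵐ[volume.restrict D]
      fun z => MvPolynomial.eval z p :=
  MemLp.coeFn_toLp (p.memLp_eval hD hb)

theorem norm_bergmanPoly_monomial {n : ℕ} {D : Set (Fin n → ℂ)} (hD : IsOpen D)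
    (hb : Bornology.IsBounded D) (α : Fin n →₀ ℕ) :
    ‖bergmanPoly hD hb (MvPolynomial.monomial α 1)‖ = monomialNorm D α := by
  rw [monomialNorm, Submodule.coe_norm, Lp.norm_def,
    eLpNorm_congr_ae (coeFn_bergmanPoly hD hb _)]
  congr 2
  ext z
  rw [MvPolynomial.eval_monomial, one_mul, Finsupp.prod_fintype _ _ fun _ => pow_zero _]

theorem inner_bergmanPoly {n : ℕ} {D : Set (Fin n → ℂ)} (hD : IsOpen D)
    (hb : Bornology.IsBounded D) (p : MvPolynomial (Fin n) ℂ) {f : bergmanSpace D}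
    {F : (Fin n → ℂ) → ℂ} (hf : f =ᵐ[volume.restrict D] F) :
    inner ℂ (bergmanPoly hD hb p) f =
      ∫ z in D, F z * (starRingEnd ℂ) (MvPolynomial.eval z p) := by
  rw [Submodule.coe_inner, L2.inner_def]
  refine integral_congr_ae ?_
  filter_upwards [coeFn_bergmanPoly hD hb p, hf] with z h1 h2
  rw [h1, h2, RCLike.inner_apply]

theorem integrable_mul_conj_eval {n : ℕ} {D : Set (Fin n → ℂ)} (hD : IsOpen D)
    (hb : Bornology.IsBounded D) (p : MvPolynomial (Fin n) ℂ) {f : bergmanSpace D}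
    {F : (Fin n → ℂ) → ℂ} (hf : f =ᵐ[volume.restrict D] F) :
    Integrable (fun z => F z * (starRingEnd ℂ) (MvPolynomial.eval z p)) (volume.restrict D) := by
  refine (integrable_congr ?_).1 (L2.integrable_inner (𝕜 := ℂ) (bergmanPoly hD hb p).1 f.1)
  filter_upwards [coeFn_bergmanPoly hD hb p, hf] with z h1 h2
  rw [h1, h2, RCLike.inner_apply]

theorem bergmanPoly_eq_zero_iff {n : ℕ} {D : Set (Fin n → ℂ)} (hD : IsOpen D)
    (hb : Bornology.IsBounded D) (p : MvPolynomial (Fin n) ℂ) :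
    bergmanPoly hD hb p = 0 ↔ ∀ z ∈ D, MvPolynomial.eval z p = 0 := by
  have hp := coeFn_bergmanPoly hD hb p
  constructor
  · intro h
    rw [h] at hp
    have h0 : (fun z => MvPolynomial.eval z p) =ᵐ[volume.restrict D] fun _ => 0 :=
      hp.symm.trans (Lp.coeFn_zero ℂ 2 _)
    exact Measure.eqOn_open_of_ae_eq h0 hD p.differentiable_eval_complex.continuous.continuousOn
      continuousOn_const
  · intro h
    refine Subtype.ext (Lp.ext (hp.trans (Filter.EventuallyEq.trans ?_ (Lp.coeFn_zero ℂ 2 _).symm)))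
    filter_upwards [ae_restrict_mem hD.measurableSet] with z hz
    exact h z hz

theorem monomialNorm_pos {n : ℕ} {D : Set (Fin n → ℂ)} (hD : IsOpen D) (h0 : 0 ∈ D)
    (hb : Bornology.IsBounded D) (α : Fin n →₀ ℕ) : 0 < monomialNorm D α := by
  rw [← norm_bergmanPoly_monomial hD hb, norm_pos_iff, Ne, bergmanPoly_eq_zero_iff]
  intro h
  obtain ⟨r, hr, hrD⟩ := Metric.isOpen_iff.1 hD 0 h0
  have hz : (fun _ : Fin n => ((r / 2 : ℝ) : ℂ)) ∈ D := hrD <| by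
    rw [mem_ball_zero_iff, pi_norm_lt_iff hr]
    intro j
    rw [Complex.norm_real, Real.norm_of_nonneg (by positivity)]
    linarith
  have := h _ hz
  rw [MvPolynomial.eval_monomial, one_mul, Finsupp.prod, Finset.prod_eq_zero_iff] at this
  obtain ⟨j, -, hj⟩ := this
  have h2 := eq_zero_of_pow_eq_zero hj
  rw [Complex.ofReal_eq_zero] at h2
  linarith

/-! ### The monomial basis -/

/-- Rotating one coordinate where the exponents differ preserves `D` and its measure. For a suitable
angle the integrand changes sign, so the integral equals its own negative. -/
theorem inner_bergmanPoly_monomial_of_ne {n : ℕ} {D : Set (Fin n → ℂ)}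
    (hD : IsCompleteReinhardtDomain D) (hb : Bornology.IsBounded D) {α β : Fin n →₀ ℕ}
    (hαβ : α ≠ β) :
    inner ℂ (bergmanPoly hD.isOpen hb (MvPolynomial.monomial α 1))
      (bergmanPoly hD.isOpen hb (MvPolynomial.monomial β 1)) = 0 := by
  obtain ⟨j, hj⟩ : ∃ j, α j ≠ β j := by
    by_contra! h
    exact hαβ (Finsupp.ext h)
  rw [inner_bergmanPoly hD.isOpen hb _ (coeFn_bergmanPoly hD.isOpen hb _)]
  set g : (Fin n → ℂ) → ℂ := fun z => MvPolynomial.eval z (MvPolynomial.monomial β 1) *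
    (starRingEnd ℂ) (MvPolynomial.eval z (MvPolynomial.monomial α 1)) with hg
  -- The angle is chosen so that `x * (β j - α j) = π`.
  set x : ℝ := Real.pi / ((β j : ℝ) - α j) with hx
  set c : Fin n → ℂ := Function.update 1 j (Complex.exp (x * Complex.I)) with hcdef
  have hc : ∀ i, ‖c i‖ = 1 := fun i => by
    rcases eq_or_ne i j with rfl | hi
    · simp [hcdef, Complex.norm_exp_ofReal_mul_I]
    · simp [hcdef, hi]
  have hpres := measurePreserving_restrict_mul hD.isOpen.measurableSet hc (hD.mul_mem_iff hc)
  have hev : ∀ (γ : Fin n →₀ ℕ) (z : Fin n → ℂ),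
      MvPolynomial.eval (c * z) (MvPolynomial.monomial γ 1) =
        Complex.exp (x * Complex.I) ^ γ j * MvPolynomial.eval z (MvPolynomial.monomial γ 1) := by
    intro γ z
    rw [MvPolynomial.eval_monomial, MvPolynomial.eval_monomial, one_mul, one_mul,
      Finsupp.prod_fintype _ _ fun _ => pow_zero _, Finsupp.prod_fintype _ _ fun _ => pow_zero _]
    simp only [Pi.mul_apply, mul_pow, Finset.prod_mul_distrib]
    congr 1
    rw [Finset.prod_eq_single j (fun i _ hi => by simp [hcdef, hi]) (by simp)]
    simp [hcdef]
  have hexp : Complex.exp (x * Complex.I) ^ β j *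
      (starRingEnd ℂ) (Complex.exp (x * Complex.I) ^ α j) = -1 := by
    rw [map_pow, ← Complex.exp_conj, map_mul, Complex.conj_ofReal, Complex.conj_I,
      ← Complex.exp_nat_mul, ← Complex.exp_nat_mul, ← Complex.exp_add, ← Complex.exp_pi_mul_I]
    congr 1
    have hne : ((β j : ℂ) - α j) ≠ 0 := sub_ne_zero.2 (by exact_mod_cast hj.symm)
    rw [hx]
    push_cast
    field_simp
    ring
  have hcg : ∀ z, g (c * z) = -g z := fun z => by
    simp only [hg, hev, map_mul]
    linear_combination (MvPolynomial.eval z (MvPolynomial.monomial β 1) *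
      (starRingEnd ℂ) (MvPolynomial.eval z (MvPolynomial.monomial α 1))) * hexp
  have hcont : Continuous g := by
    have := (MvPolynomial.monomial β (1 : ℂ)).differentiable_eval_complex.continuous
    have := (MvPolynomial.monomial α (1 : ℂ)).differentiable_eval_complex.continuous
    have := Complex.continuous_conj
    fun_prop
  have h := integral_map hpres.aemeasurable (f := g) hcont.aestronglyMeasurable
  rw [hpres.map_eq] at h
  simp only [hcg, integral_neg] at h
  exact self_eq_neg.1 h

open MvPolynomial in
/-- A function in the Bergman space of a bounded complete Reinhardt domain that is orthogonal to
all monomials vanishes. -/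
theorem eq_zero_of_forall_inner_monomial_eq_zero {n : ℕ} {D : Set (Fin n → ℂ)}
    (hD : IsCompleteReinhardtDomain D) (hb : Bornology.IsBounded D) {f : bergmanSpace D}
    (h : ∀ α, inner ℂ (bergmanPoly hD.isOpen hb (monomial α 1)) f = 0) : f = 0 := by
  have hpoly : ∀ p, inner ℂ (bergmanPoly hD.isOpen hb p) f = 0 := fun p => by
    rw [p.as_sum, map_sum, sum_inner]
    refine Finset.sum_eq_zero fun α _ => ?_
    rw [← mul_one (coeff α p), ← smul_eq_mul, ← smul_monomial, map_smul,
      inner_smul_left (bergmanPoly hD.isOpen hb (monomial α 1)) f (coeff α p), h,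
      mul_zero]
  obtain ⟨F, hF, hfF⟩ := f.2
  choose P hP hPF using fun k =>
    exists_isHomogeneous_iteratedDeriv_line k hD.isOpen hD.zero_mem hF
  have hline : ∀ z ∈ D, ∃ R : ℝ, 1 < R ∧
      DifferentiableOn ℂ (fun t : ℂ => F (t • z)) (Metric.ball 0 R) := fun z hz => by
    obtain ⟨R, hR, hRD⟩ := hD.exists_one_lt_smul_mem hz
    exact ⟨R, hR, hF.comp (by fun_prop) hRD⟩
  -- Rotation averaging turns `⟨P k, f⟩ = 0` into `⟨P k, P k⟩ / k! = 0`.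
  have hP0 : ∀ k, ∀ z ∈ D, eval z (P k) = 0 := by
    intro k
    rw [← bergmanPoly_eq_zero_iff hD.isOpen hb, ← inner_self_eq_zero (𝕜 := ℂ),
      inner_bergmanPoly hD.isOpen hb _ (coeFn_bergmanPoly hD.isOpen hb _)]
    have hrot : ∀ c : ℂ, ‖c‖ = 1 → MeasurePreserving (fun z : Fin n → ℂ => c • z)
        (volume.restrict D) (volume.restrict D) := fun c hc =>
      measurePreserving_restrict_mul (c := fun _ => c) hD.isOpen.measurableSet (fun _ => hc)
        (hD.mul_mem_iff fun _ => hc)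
    have hav := integral_circleAverage_smul hrot
      (integrable_mul_conj_eval hD.isOpen hb (P k) hfF)
    rw [← inner_bergmanPoly hD.isOpen hb (P k) hfF, hpoly] at hav
    -- For `|t| = 1`, homogeneity makes the conjugate of `P k (t z)` equal to `t⁻ᵏ` times that of `P
    -- k z`, so the average extracts the `k`-th Taylor coefficient of `t ↦ F (t z)`.
    have hcongr : ∀ z ∈ D, Real.circleAverage
        (fun t => F (t • z) * (starRingEnd ℂ) (eval (t • z) (P k))) 0 1 =
        (k.factorial : ℂ)⁻¹ * (eval z (P k) * (starRingEnd ℂ) (eval z (P k))) := by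
      intro z hz
      obtain ⟨R, hR, hd⟩ := hline z hz
      have h1 := circleAverage_inv_pow_mul k (hd.mono (Metric.closedBall_subset_ball hR))
      rw [hPF k z] at h1
      rw [← mul_assoc, ← h1, mul_comm (Real.circleAverage _ _ _), ← smul_eq_mul,
        ← Real.circleAverage_fun_smul]
      refine Real.circleAverage_congr_sphere fun t ht => ?_
      have ht1 : ‖t‖ = 1 := by simpa using ht
      have ht2 : (starRingEnd ℂ) t = t⁻¹ := by
        rw [Complex.inv_def]
        simp [Complex.normSq_eq_norm_sq, ht1]
      simp only [(hP k).eval_smul_vec, map_mul, map_pow, ht2, smul_eq_mul, inv_pow]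
      ring
    rw [setIntegral_congr_fun hD.isOpen.measurableSet hcongr, integral_const_mul] at hav
    exact (mul_eq_zero.1 hav).resolve_left (by simp [Nat.factorial_ne_zero])
  refine Subtype.ext (Lp.ext (hfF.trans (Filter.EventuallyEq.trans ?_ (Lp.coeFn_zero ℂ 2 _).symm)))
  filter_upwards [ae_restrict_mem hD.isOpen.measurableSet] with z hz
  obtain ⟨R, hR, hd⟩ := hline z hz
  -- The Taylor series along the line is evaluated at `t = 1`, where it gives `F z`.
  have hs := Complex.taylorSeries_eq_on_ball hd (z := 1) (by simpa using hR)
  simp only [hPF, hP0 _ z hz, smul_zero, tsum_zero, one_smul] at hs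
  simp [← hs]

/-- The normalized monomials. -/
noncomputable def normalizedMonomial {n : ℕ} {D : Set (Fin n → ℂ)} (hD : IsOpen D)
    (hb : Bornology.IsBounded D) (α : Fin n →₀ ℕ) : bergmanSpace D :=
  ((monomialNorm D α : ℂ))⁻¹ • bergmanPoly hD hb (MvPolynomial.monomial α 1)

theorem orthonormal_normalizedMonomial {n : ℕ} {D : Set (Fin n → ℂ)}
    (hD : IsCompleteReinhardtDomain D) (hb : Bornology.IsBounded D) :
    Orthonormal ℂ (normalizedMonomial hD.isOpen hb) := by
  refine ⟨fun α => ?_, fun α β hαβ => ?_⟩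
  · have := monomialNorm_pos hD.isOpen hD.zero_mem hb α
    rw [normalizedMonomial, norm_smul, norm_bergmanPoly_monomial, norm_inv, Complex.norm_real,
      Real.norm_of_nonneg this.le, inv_mul_cancel₀ this.ne']
  · refine (inner_smul_left (bergmanPoly hD.isOpen hb (MvPolynomial.monomial α 1))
      (normalizedMonomial hD.isOpen hb β) _).trans (mul_eq_zero_of_right _ ?_)
    refine (inner_smul_right (bergmanPoly hD.isOpen hb (MvPolynomial.monomial α 1))
      (bergmanPoly hD.isOpen hb (MvPolynomial.monomial β 1)) _).trans (mul_eq_zero_of_right _ ?_)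
    exact inner_bergmanPoly_monomial_of_ne hD hb hαβ

/-- The normalized monomials form a Hilbert basis of the Bergman space of a bounded complete
Reinhardt domain. -/
theorem exists_hilbertBasis_normalizedMonomial {n : ℕ} {D : Set (Fin n → ℂ)}
    (hD : IsCompleteReinhardtDomain D) (hb : Bornology.IsBounded D) :
    ∃ b : HilbertBasis (Fin n →₀ ℕ) ℂ (bergmanSpace D),
      ⇑b = normalizedMonomial hD.isOpen hb := by
  have := completeSpace_bergmanSpace hD.isOpen
  refine ⟨HilbertBasis.mkOfOrthogonalEqBot (orthonormal_normalizedMonomial hD hb) ?_,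
    HilbertBasis.coe_mkOfOrthogonalEqBot _ _⟩
  refine (Submodule.eq_bot_iff _).2 fun f hf => ?_
  refine eq_zero_of_forall_inner_monomial_eq_zero hD hb fun α => ?_
  have h := (Submodule.mem_orthogonal _ _).1 hf _ (Submodule.subset_span ⟨α, rfl⟩)
  rw [normalizedMonomial,
    inner_smul_left (bergmanPoly hD.isOpen hb (MvPolynomial.monomial α 1)) f] at h
  refine (mul_eq_zero.1 h).resolve_left ?_
  simpa using (monomialNorm_pos hD.isOpen hD.zero_mem hb α).ne'

/-! ### Multiplication operators -/

theorem bergmanMul_domain_eq_top {n : ℕ} {D : Set (Fin n → ℂ)} (hD : IsOpen D)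
    (hb : Bornology.IsBounded D) (p : MvPolynomial (Fin n) ℂ) : (bergmanMul D p).domain = ⊤ := by
  refine (Submodule.eq_top_iff').2 fun f => ?_
  obtain ⟨C, -, hC⟩ := p.exists_norm_eval_le hb
  refine (Lp.memLp f.1).of_le_mul (c := C)
    (p.differentiable_eval_complex.continuous.aestronglyMeasurable.mul
      (Lp.aestronglyMeasurable f.1)) ?_
  filter_upwards [ae_restrict_mem hD.measurableSet] with z hz
  rw [norm_mul]
  exact mul_le_mul_of_nonneg_right (hC z hz) (norm_nonneg _)

/-- Multiplication by a polynomial on the Bergman space of a bounded open set is an everywhere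
defined bounded operator. -/
theorem exists_bergmanMul_eq_toPMap {n : ℕ} {D : Set (Fin n → ℂ)} (hD : IsOpen D)
    (hb : Bornology.IsBounded D) (p : MvPolynomial (Fin n) ℂ) :
    ∃ M : bergmanSpace D →L[ℂ] bergmanSpace D,
      bergmanMul D p = (M : bergmanSpace D →ₗ[ℂ] bergmanSpace D).toPMap ⊤ ∧
      ∀ q, M (bergmanPoly hD hb q) = bergmanPoly hD hb (p * q) := by
  obtain ⟨C, -, hC⟩ := p.exists_norm_eval_le hb
  have htop := bergmanMul_domain_eq_top hD hb p
  have hdom : ∀ f, f ∈ (bergmanMul D p).domain := fun f => htop ▸ Submodule.mem_top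
  have hcoe : ∀ f : bergmanSpace D, (bergmanMul D p ⟨f, hdom f⟩ : (Fin n → ℂ) → ℂ)
      =ᵐ[volume.restrict D] fun z => MvPolynomial.eval z p * (f : (Fin n → ℂ) → ℂ) z := fun f =>
    MemLp.coeFn_toLp (hdom f)
  let T : bergmanSpace D →ₗ[ℂ] bergmanSpace D :=
    (bergmanMul D p).toFun.comp (LinearMap.codRestrict _ LinearMap.id hdom)
  have hT : ∀ f, ‖T f‖ ≤ C * ‖f‖ := fun f => by
    refine Lp.norm_le_mul_norm_of_ae_le_mul ?_
    filter_upwards [hcoe f, ae_restrict_mem hD.measurableSet] with z h1 hz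
    refine (congrArg norm h1).le.trans ?_
    rw [norm_mul]
    exact mul_le_mul_of_nonneg_right (hC z hz) (norm_nonneg _)
  refine ⟨T.mkContinuous C hT, LinearPMap.ext htop fun f hf hf' => rfl, fun q => ?_⟩
  refine Subtype.ext (Lp.ext ((hcoe _).trans ?_))
  filter_upwards [coeFn_bergmanPoly hD hb q, coeFn_bergmanPoly hD hb (p * q)] with z h1 h2
  rw [LinearMap.id_apply, h1, h2, map_mul]

theorem normalizedMonomial_eq {n : ℕ} {D : Set (Fin n → ℂ)} (hD : IsOpen D) (h0 : 0 ∈ D)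
    (hb : Bornology.IsBounded D) (α : Fin n →₀ ℕ) :
    bergmanPoly hD hb (MvPolynomial.monomial α 1) =
      (monomialNorm D α : ℂ) • normalizedMonomial hD hb α := by
  have : (monomialNorm D α : ℂ) ≠ 0 := by exact_mod_cast (monomialNorm_pos hD h0 hb α).ne'
  rw [normalizedMonomial, smul_inv_smul₀ this]

/-- Source of the weights: expanding `p z^α` into monomials and renormalizing each one produces the
ratio of norms. -/
theorem bergmanMul_normalizedMonomial {n : ℕ} {D : Set (Fin n → ℂ)} (hD : IsOpen D) (h0 : 0 ∈ D)
    (hb : Bornology.IsBounded D) (p : MvPolynomial (Fin n) ℂ)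
    {M : bergmanSpace D →L[ℂ] bergmanSpace D}
    (hM : ∀ q, M (bergmanPoly hD hb q) = bergmanPoly hD hb (p * q)) (α : Fin n →₀ ℕ) :
    M (normalizedMonomial hD hb α) =
      ∑ u ∈ p.support, shiftWeight D p α (α + u) • normalizedMonomial hD hb (α + u) := by
  have hp : p * MvPolynomial.monomial α 1 =
      ∑ u ∈ p.support, p.coeff u • MvPolynomial.monomial (α + u) 1 := by
    conv_lhs => rw [p.as_sum, Finset.sum_mul]
    refine Finset.sum_congr rfl fun u _ => ?_
    rw [MvPolynomial.monomial_mul, MvPolynomial.smul_monomial, smul_eq_mul, add_comm]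
  rw [normalizedMonomial, map_smul, hM, hp, map_sum, Finset.smul_sum]
  refine Finset.sum_congr rfl fun u _ => ?_
  rw [map_smul, normalizedMonomial_eq hD h0, smul_smul, smul_smul, shiftWeight,
    add_tsub_cancel_left]
  congr 1
  push_cast
  ring

/-! ### The shift graph and its weighted shift -/

/-- Parents of `β` lie below `β` coordinatewise. Square summability is then automatic for any
weights. -/
theorem finite_par_shiftGraph {n : ℕ} (p : MvPolynomial (Fin n) ℂ) (β : Fin n →₀ ℕ) :
    ((shiftGraph p).Par β).Finite :=
  (Set.finite_Iic β).subset fun _ ⟨_, _, h⟩ => Set.mem_Iic.2 (h ▸ le_self_add)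

theorem squareSummableWeights_shiftGraph {n : ℕ} (p : MvPolynomial (Fin n) ℂ)
    (w : (Fin n →₀ ℕ) → (Fin n →₀ ℕ) → ℂ) : (shiftGraph p).SquareSummableWeights w := fun β => by
  have := (finite_par_shiftGraph p β).to_subtype
  exact Summable.of_finite

/-- A bounded operator that acts on the standard basis of `ℓ²(V)` as a weighted shift is the
weighted shift. -/
theorem Digraph.weightedShift_eq_toPMap {V : Type*} [DecidableEq V] {G : Digraph V}
    {w : V → V → ℂ} (hw : G.SquareSummableWeights w) {L : EllTwo V →L[ℂ] EllTwo V}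
    (hL : ∀ α β, (L (lp.single 2 α 1) : V → ℂ) β = (G.Par β).indicator (fun α => w α β) α) :
    G.weightedShift w hw = (L : EllTwo V →ₗ[ℂ] EllTwo V).toPMap ⊤ := by
  have key : ∀ f : EllTwo V, G.formalShift w f = L f := fun f => by
    funext β
    -- Continuity of the `β`-coordinate of `L` allows evaluation term by term on the expansion of
    -- `f`. Only parents of `β` contribute.
    have h1 := (lp.hasSum_single (p := 2) (by norm_num) f).mapL
      ((lp.evalCLM ℂ (fun _ : V => ℂ) 2 β).comp L)
    have h2 : ∀ α, ((lp.evalCLM ℂ (fun _ : V => ℂ) 2 β).comp L) (lp.single 2 α (f α)) =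
        (G.Par β).indicator (fun α => w α β * f α) α := fun α => by
      have h3 : (lp.single 2 α (f α) : EllTwo V) = f α • lp.single 2 α (1 : ℂ) := by
        rw [← lp.single_smul, smul_eq_mul, mul_one]
      rw [h3, map_smul]
      refine (congrArg (f α * ·) (hL α β)).trans ?_
      by_cases h : α ∈ G.Par β <;> simp [h, mul_comm]
    simp only [h2] at h1
    have h4 : ∑' u : G.Par β, w u β * f u = (L f : V → ℂ) β :=
      (tsum_subtype (G.Par β) fun α => w α β * f α).trans h1.tsum_eq
    rw [Digraph.formalShift]
    -- At a root the prescribed value `0` agrees with the empty sum.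
    split_ifs with h
    · rw [← h4, Digraph.IsRoot] at *
      rw [h, tsum_empty]
    · exact h4
  refine LinearPMap.ext ?_ fun f hf hf' => Subtype.ext (key f)
  refine (Submodule.eq_top_iff').2 fun f => ?_
  change Memℓp (G.formalShift w f) 2
  rw [key]
  exact lp.memℓp _

/-- Without a constant term every edge goes strictly up in `ℕ₀ⁿ`, which excludes loops and circuits.
The children of `u` form a translate of the support, so its cardinality is an admissible bound and a
least one exists. -/
theorem isGeneralizedDirectedSemiTree_shiftGraph {n : ℕ} (p : MvPolynomial (Fin n) ℂ)
    (hp : 0 ∉ p.support) :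
    ∃ c : ℕ, c ≤ p.support.card ∧ (shiftGraph p).IsGeneralizedDirectedSemiTree c := by
  classical
  set S : Set ℕ := {k : ℕ | ∀ u v : Fin n →₀ ℕ, u ≠ v →
    ((shiftGraph p).Chi u ∩ (shiftGraph p).Chi v).encard ≤ (k : ℕ∞)} with hS
  have hcard : p.support.card ∈ S := fun u v _ => by
    have hsub : (shiftGraph p).Chi u ∩ (shiftGraph p).Chi v ⊆
        ((p.support.image (u + ·) : Finset (Fin n →₀ ℕ)) : Set (Fin n →₀ ℕ)) := by
      rintro _ ⟨⟨x, hx, rfl⟩, -⟩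
      simpa using hx
    refine (Set.encard_le_encard hsub).trans ?_
    rw [Set.encard_coe_eq_coe_finsetCard]
    exact_mod_cast Finset.card_image_le
  have hlt : ∀ α β, (shiftGraph p).Adj α β → α < β := by
    rintro α _ ⟨u, hu, rfl⟩
    exact lt_add_of_pos_right α (pos_iff_ne_zero.2 fun h => hp (h ▸ hu))
  refine ⟨sInf S, Nat.sInf_le hcard, ⟨0⟩, fun v hv => lt_irrefl v (hlt v v hv), ?_, ?_,
    Nat.sInf_mem ⟨_, hcard⟩, fun k hk => Nat.sInf_le hk⟩
  · rintro ⟨k, c, -, -, hc, hk⟩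
    have : ∀ j ≤ k, c 0 ≤ c j := by
      intro j
      induction j with
      | zero => exact fun _ => le_rfl
      | succ j ih => exact fun hj => (ih (by omega)).trans (hlt _ _ (hc j (by omega))).le
    exact (hlt _ _ hk).not_ge (this k le_rfl)
  · exact inferInstanceAs (Countable (Quot _))

/-- A nonzero constant term forces degree `0`, so the polynomial would be a constant, which is
algebraic over `R`. -/
theorem zero_notMem_support_of_isHomogeneous {σ R : Type*} [CommRing R] [Nontrivial R]
    {ι : Type*} {θ : ι → MvPolynomial σ R} (hθ : AlgebraicIndependent R θ) {i : ι} {d : ℕ}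
    (hd : (θ i).IsHomogeneous d) : (0 : σ →₀ ℕ) ∉ (θ i).support := by
  intro h0
  have hd0 : d = 0 := by simpa using (hd (MvPolynomial.mem_support_iff.1 h0)).symm
  subst hd0
  have hC : θ i = MvPolynomial.C ((θ i).coeff 0) :=
    MvPolynomial.totalDegree_eq_zero_iff_eq_C.1
      ((MvPolynomial.totalDegree_zero_iff_isHomogeneous _).2 hd)
  exact (hθ.transcendental i) (hC ▸ isAlgebraic_algebraMap ((θ i).coeff 0))

/-! ### The unitary equivalence -/

theorem mainTheorem3 {n : ℕ}
    (G : Subgroup ((Fin n → ℂ) ≃ₗ[ℂ] (Fin n → ℂ))) (hG : IsFinitePseudoreflectionGroup G)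
    (θ : Fin n → MvPolynomial (Fin n) ℂ) (hθ : IsBasicPolynomials G θ)
    (D : Set (Fin n → ℂ)) (hD : IsCompleteReinhardtDomain D) (hb : Bornology.IsBounded D)
    (hinv : ∀ σ ∈ G, ∀ z ∈ D, σ z ∈ D) :
    (∀ i, ∃ c' : ℕ, c' ≤ (θ i).support.card ∧
      (shiftGraph (θ i)).IsGeneralizedDirectedSemiTree c') ∧
    ∃ U : EllTwo (Fin n →₀ ℕ) ≃ₗᵢ[ℂ] bergmanSpace D,
      ∀ i, ∃ (hw : (shiftGraph (θ i)).SquareSummableWeights (shiftWeight D (θ i)))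
        (L : EllTwo (Fin n →₀ ℕ) →L[ℂ] EllTwo (Fin n →₀ ℕ))
        (M : bergmanSpace D →L[ℂ] bergmanSpace D),
        (shiftGraph (θ i)).weightedShift (shiftWeight D (θ i)) hw =
          (L : EllTwo (Fin n →₀ ℕ) →ₗ[ℂ] EllTwo (Fin n →₀ ℕ)).toPMap ⊤ ∧
        bergmanMul D (θ i) = (M : bergmanSpace D →ₗ[ℂ] bergmanSpace D).toPMap ⊤ ∧
        (∀ α : Fin n →₀ ℕ, L (lp.single 2 α 1) =
          ∑ u ∈ (θ i).support, shiftWeight D (θ i) α (α + u) • lp.single 2 (α + u) 1) ∧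
        ∀ f : EllTwo (Fin n →₀ ℕ), U (L f) = M (U f) := by
  refine ⟨fun i => ?_, ?_⟩
  · obtain ⟨d, hd⟩ := hθ.homogeneous i
    exact isGeneralizedDirectedSemiTree_shiftGraph _
      (zero_notMem_support_of_isHomogeneous hθ.algebraicIndependent hd)
  obtain ⟨b, hbm⟩ := exists_hilbertBasis_normalizedMonomial hD hb
  -- This unitary sends `χ_α` to the normalized monomial at `α`. With `L` defined by conjugating
  -- `M`, intertwining holds by construction, and it remains to recognize `L` as the weighted shift.
  refine ⟨b.repr.symm, fun i => ?_⟩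
  obtain ⟨M, hM, hMq⟩ := exists_bergmanMul_eq_toPMap hD.isOpen hb (θ i)
  set L : EllTwo (Fin n →₀ ℕ) →L[ℂ] EllTwo (Fin n →₀ ℕ) :=
    (b.repr.toContinuousLinearEquiv : bergmanSpace D →L[ℂ] EllTwo (Fin n →₀ ℕ)) ∘L M ∘L
      (b.repr.symm.toContinuousLinearEquiv : EllTwo (Fin n →₀ ℕ) →L[ℂ] bergmanSpace D) with hL
  have hLf : ∀ f, L f = b.repr (M (b.repr.symm f)) := fun f => rfl
  have hsingle : ∀ α : Fin n →₀ ℕ, L (lp.single 2 α 1) =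
      ∑ u ∈ (θ i).support, shiftWeight D (θ i) α (α + u) • lp.single 2 (α + u) 1 := fun α => by
    rw [hLf, b.repr_symm_single, hbm,
      bergmanMul_normalizedMonomial hD.isOpen hD.zero_mem hb (θ i) hMq, map_sum]
    refine Finset.sum_congr rfl fun u _ => ?_
    rw [map_smul, ← hbm, b.repr_self]
  refine ⟨squareSummableWeights_shiftGraph _ _, L, M,
    Digraph.weightedShift_eq_toPMap _ fun α β => ?_, hM, hsingle, fun f => ?_⟩
  · rw [hsingle, lp.coeFn_sum, Finset.sum_apply]
    simp only [lp.coeFn_smul, Pi.smul_apply, lp.single_apply, smul_eq_mul]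
    by_cases h : α ∈ (shiftGraph (θ i)).Par β
    · rw [Set.indicator_of_mem h]
      obtain ⟨u, hu, rfl⟩ := h
      -- Translation by `α` is injective, so only the exponent `u` reaches the vertex `α + u`.
      rw [Finset.sum_eq_single_of_mem u hu fun v _ hv => ?_]
      · simp
      · rw [Pi.single_eq_of_ne (by simpa using hv.symm), mul_zero]
    · rw [Set.indicator_of_notMem h]
      refine Finset.sum_eq_zero fun u hu => ?_
      rw [Pi.single_eq_of_ne (fun hβ => h ⟨u, hu, hβ⟩), mul_zero]
  · rw [hLf, LinearIsometryEquiv.symm_apply_apply]
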